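/- Let $T$ be a locally finite tree with root $v$, and let $v_1,\dots,v_n$ be the children (neighbours) of $v$, where $n\ge 2$. For each $i$ let $T_i$ be the subtree rooted at $v_i$, i.e. the subgraph of $T$ induced on the vertices $w$ such that the path in $T$ from $v$ to $w$ passes through $v_i$. Suppose that, for every $i$, the simple random walk on $T_i$ is transient. Then the Poisson boundary of the simple random walk on $T$ is nontrivial: for every starting vertex $x$, if $P_x$ denotes the law on the space $V(T)^{\mathbb{Z}_{\ge 0}}$ of trajectories of the simple random walk on $T$ started at $x$, there is a measurable set $A$ of trajectories that is invariant under the time shift $(Z_k)_{k\ge 0}\mapsto (Z_{k+1})_{k\ge 0}$ and satisfies $0<P_x(A)<1$. -/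

import Mathlib

namespace TreeWalk

open MeasureTheory ProbabilityTheory

/-- Induced subgraphs of locally finite graphs are locally finite. -/
noncomputable instance induceLocallyFinite {V : Type*} (G : SimpleGraph V) [G.LocallyFinite]
    (s : Set V) : (G.induce s).LocallyFinite := fun x =>
  Fintype.ofInjective
    (fun y : (G.induce s).neighborSet x => (⟨y.1.1, y.2⟩ : G.neighborSet x.1))
    (fun _ _ h => Subtype.ext (Subtype.ext (congrArg (fun z => z.1) h)))

/-- A subset of a discrete measurable space is a discrete measurable space. -/
instance subtypeDiscrete {V : Type*} [MeasurableSpace V] [DiscreteMeasurableSpace V] (s : Set V) :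
    DiscreteMeasurableSpace s :=
  ⟨fun t => ⟨Subtype.val '' t, MeasurableSet.of_discrete,
    Set.preimage_image_eq t Subtype.val_injective⟩⟩

section Walk

variable {V : Type*} (G : SimpleGraph V) [G.LocallyFinite]

open Classical in
/-- One step of the simple random walk from `x`: a uniformly chosen neighbour of `x`.
At an isolated vertex the walk stays put. -/
noncomputable def step (x : V) : PMF V :=
  if h : (G.neighborFinset x).Nonempty then PMF.uniformOfFinset (G.neighborFinset x) h
  else PMF.pure x

variable [MeasurableSpace V] [DiscreteMeasurableSpace V]

/-- The transition kernel of the simple random walk. -/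
noncomputable def stepKernel : Kernel V V where
  toFun x := (step G x).toMeasure
  measurable' := Measurable.of_discrete

instance : IsMarkovKernel (stepKernel G) :=
  ⟨fun x => inferInstanceAs (IsProbabilityMeasure (step G x).toMeasure)⟩

/-- The law of `Z_{n+1}` given `(Z_0, …, Z_n)`: one step of the walk from `Z_n`. -/
noncomputable def transition (n : ℕ) : Kernel (Finset.Iic n → V) V :=
  (stepKernel G).comap (fun z => z ⟨n, Finset.mem_Iic.2 le_rfl⟩) (measurable_pi_apply _)

instance (n : ℕ) : IsMarkovKernel (transition G n) := by
  unfold transition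
  infer_instance

/-- The law, on the trajectory space `V^ℕ` with the product σ-algebra, of the simple random
walk on `G` started at `x`. -/
noncomputable def law (x : V) : Measure (ℕ → V) :=
  Kernel.traj (X := fun _ => V) (transition G) 0 (fun _ => x)

/-- The simple random walk on `G` is transient: from every vertex, the probability of ever
returning to it is less than one. -/
def Transient : Prop :=
  ∀ x : V, law G x {z | ∃ n : ℕ, 1 ≤ n ∧ z n = x} < 1

/-- The time shift on trajectories. -/
def shift (z : ℕ → V) : ℕ → V := fun n => z (n + 1)

/-- The boundary of the simple random walk on `G` started at `x` is the space of ergodic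
components of the time shift on `(V^ℕ, law G x)`, that is, the quotient of that space determined
by the σ-algebra of shift-invariant events. It is nontrivial when this σ-algebra contains an event
whose probability is neither `0` nor `1`. -/
def BoundaryNontrivial (x : V) : Prop :=
  ∃ A : Set (ℕ → V), MeasurableSet[MeasurableSpace.invariants (shift (V := V))] A ∧
    0 < law G x A ∧ law G x A < 1

end Walk

/-- The vertex set of the subtree rooted at `u` of a tree `G` with root `r`: the vertices `w`
such that the path from `r` to `w` passes through `u`. -/
def descendants {V : Type*} (G : SimpleGraph V) (r u : V) : Set V :=
  {w | ∀ p : G.Walk r w, p.IsPath → u ∈ p.support}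

end TreeWalk

/-! For a child `u` of the root, ending up in the subtree at `u` is a shift-invariant event, and the
events of two children are disjoint. If both have positive probability, neither has probability one.
Positivity: transience gives a vertex of the subtree from which its own walk avoids `u` forever with
positive probability. Away from `u` the subtree and the tree have the same neighbours, so the walk
on the tree stays in the subtree with that probability (`law_induce_staying`). For invariant `A`, `x
↦ law G x A` is harmonic, so a zero would spread to the whole connected graph
(`law_eq_zero_of_connected`). -/

namespace TreeWalk

open MeasureTheory ProbabilityTheory

/-! ### Cylinder events -/

section Trajectories

variable {V : Type*}

/-- The trajectories that agree with `a` up to time `n`. -/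
def agreeing (a : ℕ → V) (n : ℕ) : Set (ℕ → V) := {z | ∀ i ≤ n, z i = a i}

lemma agreeing_eq_preimage (a : ℕ → V) (n : ℕ) :
    agreeing a n = Preorder.frestrictLe (π := fun _ => V) n ⁻¹' {Preorder.frestrictLe n a} := by
  ext z
  simp [agreeing, funext_iff]

/-- Prepending a vertex to a trajectory. -/
def prepend (x : V) (z : ℕ → V) : ℕ → V
  | 0 => x
  | n + 1 => z n

lemma measurable_prepend [MeasurableSpace V] (x : V) : Measurable (prepend x) := by
  refine measurable_pi_iff.2 fun n => ?_
  cases n with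
  | zero => exact measurable_const
  | succ n => exact measurable_pi_apply n

end Trajectories

/-! ### Finite-path probabilities and the Markov property -/

section Markov

variable {V : Type*} (G : SimpleGraph V) [G.LocallyFinite]
  [MeasurableSpace V] [DiscreteMeasurableSpace V]

instance (x : V) : IsProbabilityMeasure (law G x) := by
  unfold law; infer_instance

lemma measurableSet_agreeing (a : ℕ → V) (n : ℕ) : MeasurableSet (agreeing a n) := by
  rw [agreeing_eq_preimage]
  exact Preorder.measurable_frestrictLe n (measurableSet_singleton _)

-- Given the history `w`, only the vertex at time `n + 1` matters, and only if `w` follows `a`.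
open Classical in
lemma traj_agreeing_succ (a : ℕ → V) (n : ℕ) (w : Finset.Iic n → V) :
    Kernel.traj (X := fun _ => V) (transition G) n w (agreeing a (n + 1)) =
      ({Preorder.frestrictLe (π := fun _ => V) n a} : Set (Finset.Iic n → V)).indicator
        (fun _ => step G (a n) (a (n + 1))) w := by
  rw [← Kernel.traj_map_updateFinset, Measure.map_apply measurable_updateFinset_left
    (measurableSet_agreeing a (n + 1))]
  by_cases hw : w = Preorder.frestrictLe (π := fun _ => V) n a
  · have hset : (fun z : ℕ → V => Function.updateFinset z (Finset.Iic n) w) ⁻¹'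
        agreeing a (n + 1) = (fun z => z (n + 1)) ⁻¹' {a (n + 1)} := by
      ext z
      simp only [agreeing, Set.mem_preimage, Set.mem_ofPred_eq, Set.mem_singleton_iff,
        Function.updateFinset, hw]
      constructor
      · intro h
        simpa using h (n + 1) le_rfl
      · intro h i hi
        by_cases hin : i ≤ n
        · simp [hin]
        · obtain rfl : i = n + 1 := by omega
          simpa using h
    rw [hset, ← Measure.map_apply (measurable_pi_apply _) (measurableSet_singleton _),
      ← Kernel.map_apply _ (measurable_pi_apply _), Kernel.map_traj_succ_self, hw]
    simp [transition, stepKernel, Kernel.comap_apply, PMF.toMeasure_apply_singleton]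
  · rw [Set.indicator_of_notMem (by simpa using hw)]
    convert measure_empty (μ := Kernel.traj (X := fun _ => V) (transition G) n w)
    ext z
    simp only [Set.mem_preimage, Set.mem_empty_iff_false, iff_false]
    intro h
    refine hw (funext fun i => ?_)
    have := h i.1 ((Finset.mem_Iic.1 i.2).trans n.le_succ)
    simpa [Function.updateFinset, Finset.mem_Iic.1 i.2] using this

lemma law_agreeing_succ (x : V) (a : ℕ → V) (n : ℕ) :
    law G x (agreeing a (n + 1)) = step G (a n) (a (n + 1)) * law G x (agreeing a n) := by
  have h := Kernel.traj_comp_partialTraj (X := fun _ => V) (κ := transition G) (Nat.zero_le n)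
  have h2 := Kernel.traj_map_frestrictLe_apply (X := fun _ => V) (κ := transition G) 0 n
    (fun _ => x)
  conv_lhs => rw [law, ← h]
  rw [Kernel.comp_apply' _ _ _ (measurableSet_agreeing a (n + 1))]
  simp_rw [traj_agreeing_succ]
  rw [lintegral_indicator_const (measurableSet_singleton _), ← h2,
    Measure.map_apply (Preorder.measurable_frestrictLe n) (measurableSet_singleton _),
    ← agreeing_eq_preimage]
  rfl

open Classical in
lemma law_agreeing_zero (x : V) (a : ℕ → V) :
    law G x (agreeing a 0) = if a 0 = x then 1 else 0 := by
  have h2 := Kernel.traj_map_frestrictLe_apply (X := fun _ => V) (κ := transition G) 0 0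
    (fun _ => x)
  rw [agreeing_eq_preimage, ← Measure.map_apply (Preorder.measurable_frestrictLe 0)
    (measurableSet_singleton _), law, h2, Kernel.partialTraj_self, Kernel.id_apply,
    Measure.dirac_apply' _ (measurableSet_singleton _), Set.indicator_apply]
  congr 1
  simp only [Set.mem_singleton_iff, funext_iff, eq_iff_iff]
  constructor
  · intro h
    exact (h ⟨0, by simp⟩).symm
  · rintro h ⟨i, hi⟩
    obtain rfl : i = 0 := by simpa using hi
    exact h.symm

open Classical in
lemma law_agreeing (x : V) (a : ℕ → V) (n : ℕ) :
    law G x (agreeing a n) =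
      if a 0 = x then ∏ i ∈ Finset.range n, step G (a i) (a (i + 1)) else 0 := by
  induction n with
  | zero => simp [law_agreeing_zero]
  | succ n ih =>
    rw [law_agreeing_succ, ih, Finset.prod_range_succ]
    split_ifs <;> simp [mul_comm]

/-- Two laws on trajectories in a countable space agree if they give the same mass to all
finite paths. -/
lemma measure_ext_of_agreeing [Countable V] {μ ν : Measure (ℕ → V)} [IsProbabilityMeasure μ]
    [IsProbabilityMeasure ν] (h : ∀ a n, μ (agreeing a n) = ν (agreeing a n)) : μ = ν := by
  refine ext_of_generate_finite _ generateFrom_measurableCylinders.symm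
    isPiSystem_measurableCylinders ?_ (by simp)
  intro t ht
  obtain ⟨N, S, mS, rfl⟩ : ∃ N S, MeasurableSet S ∧ t = cylinder (Finset.Iic N) S := by
    simpa [measurableCylinders_nat] using ht
  have hmap : μ.map (Preorder.frestrictLe (π := fun _ => V) N) =
      ν.map (Preorder.frestrictLe (π := fun _ => V) N) := by
    refine Measure.ext_of_singleton fun w => ?_
    rw [Measure.map_apply (Preorder.measurable_frestrictLe N) (measurableSet_singleton _),
      Measure.map_apply (Preorder.measurable_frestrictLe N) (measurableSet_singleton _)]
    -- Extend the finite path by freezing it at time `N`.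
    obtain ⟨a, rfl⟩ : ∃ a : ℕ → V, Preorder.frestrictLe (π := fun _ => V) N a = w :=
      ⟨fun i => w ⟨min i N, by simp⟩, funext fun ⟨i, hi⟩ => by
        have : i ≤ N := by simpa using hi
        simp [this]⟩
    rw [← agreeing_eq_preimage, h]
  have hS := congrArg (fun m => m S) hmap
  rwa [Measure.map_apply (Preorder.measurable_frestrictLe N) mS,
    Measure.map_apply (Preorder.measurable_frestrictLe N) mS] at hS

/-- The Markov property at time one. -/
lemma law_eq_map_bind [Countable V] (x : V) :
    law G x = ((stepKernel G x).bind (law G)).map (prepend x) := by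
  have : IsProbabilityMeasure ((stepKernel G x).bind (law G)) :=
    isProbabilityMeasure_bind Measurable.of_discrete.aemeasurable (.of_forall inferInstance)
  have := Measure.isProbabilityMeasure_map (μ := (stepKernel G x).bind (law G))
    (measurable_prepend x).aemeasurable
  refine measure_ext_of_agreeing fun a n => ?_
  classical
  rw [Measure.map_apply (measurable_prepend x) (measurableSet_agreeing a n)]
  by_cases hx : a 0 = x
  · cases n with
    | zero =>
      have : prepend x ⁻¹' agreeing a 0 = Set.univ := by
        ext z; simp [agreeing, prepend, hx]
      simp [this, law_agreeing, hx]
    | succ n =>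
      have hset : prepend x ⁻¹' agreeing a (n + 1) = agreeing (fun i => a (i + 1)) n := by
        ext z
        simp only [agreeing, Set.mem_preimage, Set.mem_ofPred_eq]
        constructor
        · intro h i hi
          exact h (i + 1) (by omega)
        · rintro h (_ | i) hi
          · exact hx.symm
          · exact h i (by omega)
      rw [hset, Measure.bind_apply (measurableSet_agreeing _ n)
        Measurable.of_discrete.aemeasurable]
      have hind : ∀ y, law G y (agreeing (fun i => a (i + 1)) n) =
          ({a 1} : Set V).indicator (fun _ => ∏ i ∈ Finset.range n,
            step G (a (i + 1)) (a (i + 1 + 1))) y := by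
        intro y
        rw [law_agreeing, Set.indicator_apply]
        simp [eq_comm]
      simp_rw [hind]
      rw [lintegral_indicator_const (measurableSet_singleton _), law_agreeing, if_pos hx,
        Finset.prod_range_succ']
      simp [stepKernel, PMF.toMeasure_apply_singleton, hx]
  · have : prepend x ⁻¹' agreeing a n = ∅ := by
      ext z
      simp only [agreeing, Set.mem_preimage, Set.mem_ofPred_eq, Set.mem_empty_iff_false, iff_false]
      intro h
      exact hx (h 0 (Nat.zero_le _)).symm
    simp [this, law_agreeing, hx]

/-- First-step analysis, the source of harmonicity and of the recursions below. -/
lemma law_apply [Countable V] (x : V) {A : Set (ℕ → V)} (hA : MeasurableSet A) :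
    law G x A = ∫⁻ y, law G y (prepend x ⁻¹' A) ∂(step G x).toMeasure := by
  conv_lhs => rw [law_eq_map_bind, Measure.map_apply (measurable_prepend x) hA,
    Measure.bind_apply (measurable_prepend x hA) Measurable.of_discrete.aemeasurable]
  rfl

end Markov
-- Subtrees of a rooted tree
section Graph

variable {V : Type*} (G : SimpleGraph V)

/-- A connected locally finite graph is countable. -/
lemma countable_of_connected [G.LocallyFinite] (hG : G.Connected) : Countable V := by
  obtain ⟨v⟩ := hG.nonempty
  have hn : ∀ n : ℕ, {w | ∃ p : G.Walk w v, p.length = n}.Countable := by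
    intro n
    induction n with
    | zero =>
      refine (Set.countable_singleton v).mono ?_
      rintro w ⟨p, hp⟩
      exact p.eq_of_length_eq_zero hp
    | succ n ih =>
      refine (ih.biUnion fun x _ => (Set.toFinite (G.neighborSet x)).countable).mono ?_
      rintro w ⟨p, hp⟩
      cases p with
      | nil => simp at hp
      | cons h p => exact Set.mem_biUnion ⟨p, by simpa using hp⟩ h.symm
  rw [← Set.countable_univ_iff]
  refine (Set.countable_iUnion hn).mono fun w _ => ?_
  obtain ⟨p⟩ := hG.preconnected w v
  exact Set.mem_iUnion.2 ⟨p.length, p, rfl⟩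

lemma mem_descendants_self (r u : V) : u ∈ descendants G r u :=
  fun p _ => p.end_mem_support

/-- A subtree can only be left through its root. -/
lemma mem_descendants_of_adj {r u w w' : V} (hw : w ∈ descendants G r u) (hwu : w ≠ u)
    (h : G.Adj w w') : w' ∈ descendants G r u := by
  classical
  intro p hp
  by_contra hu
  -- Either `p` has an initial segment ending at `w`, or it extends to a path to `w`; that path
  -- contains `u`, which is not `w`.
  by_cases hwp : w ∈ p.support
  · exact hu (p.support_takeUntil_subset_support hwp (hw _ (hp.takeUntil hwp)))
  · have := hw _ (hp.concat hwp h.symm)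
    rw [SimpleGraph.Walk.support_concat, List.mem_append] at this
    rcases this with h | h
    · exact hu h
    · exact hwu (List.mem_singleton.1 h).symm

variable {G}

/-- The subtrees rooted at distinct children of the root are disjoint. -/
lemma disjoint_descendants (hG : G.IsTree) {r u u' : V} (hu : G.Adj r u) (hu' : G.Adj r u')
    (hne : u ≠ u') : Disjoint (descendants G r u) (descendants G r u') := by
  classical
  rw [Set.disjoint_left]
  intro w hw hw'
  obtain ⟨p, hp⟩ := hG.connected.exists_isPath r w
  -- By uniqueness of paths, `p` reaches a child of the root only along the edge from the root.
  have key : ∀ t, G.Adj r t → t ∈ p.support → p.snd = t := by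
    intro t ht htp
    have hq : p.takeUntil t htp = ht.toWalk := congrArg Subtype.val
      ((hG.isAcyclic.subsingleton_path r t).elim ⟨_, hp.takeUntil htp⟩
        (SimpleGraph.Path.singleton ht))
    rw [← SimpleGraph.Walk.snd_takeUntil ht.ne' p htp, hq]
    simp
  exact hne ((key u hu (hw p hp)).symm.trans (key u' hu' (hw' p hp)))

end Graph

/-! ### Tail events -/

section Trajectories

variable {V : Type*}

/-- The trajectories that are eventually in `s`. -/
def eventuallyIn (s : Set V) : Set (ℕ → V) := {z | ∃ N, ∀ n ≥ N, z n ∈ s}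

lemma shift_preimage_eventuallyIn (s : Set V) : shift ⁻¹' eventuallyIn s = eventuallyIn s := by
  ext z
  constructor
  · rintro ⟨N, h⟩
    refine ⟨N + 1, fun n hn => ?_⟩
    obtain ⟨m, rfl⟩ : ∃ m, n = m + 1 := ⟨n - 1, by omega⟩
    exact h m (by omega)
  · rintro ⟨N, h⟩
    exact ⟨N, fun n hn => h (n + 1) (by omega)⟩

lemma disjoint_eventuallyIn {s t : Set V} (h : Disjoint s t) :
    Disjoint (eventuallyIn s) (eventuallyIn t) := by
  rw [Set.disjoint_left]
  rintro z ⟨M, hM⟩ ⟨N, hN⟩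
  exact Set.disjoint_left.1 h (hM _ (le_max_left M N)) (hN _ (le_max_right M N))

end Trajectories

/-! ### Harmonicity, comparison of walks, transience -/

section Walk

variable {V : Type*} (G : SimpleGraph V) [G.LocallyFinite]
  [MeasurableSpace V] [DiscreteMeasurableSpace V]

lemma lintegral_step_of_nonempty [Countable V] {x : V} (hx : (G.neighborFinset x).Nonempty)
    (f : V → ENNReal) :
    ∫⁻ y, f y ∂(step G x).toMeasure =
      (∑ y ∈ G.neighborFinset x, f y) * ((G.neighborFinset x).card : ENNReal)⁻¹ := by
  rw [lintegral_countable', tsum_eq_sum (s := G.neighborFinset x), Finset.sum_mul]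
  · refine Finset.sum_congr rfl fun y hy => ?_
    rw [PMF.toMeasure_apply_singleton _ _ (measurableSet_singleton _), step, dif_pos hx,
      PMF.uniformOfFinset_apply_of_mem _ hy]
  · intro y hy
    rw [PMF.toMeasure_apply_singleton _ _ (measurableSet_singleton _), step, dif_pos hx,
      PMF.uniformOfFinset_apply_of_notMem _ hy, mul_zero]

lemma lintegral_step_of_isolated {x : V} (hx : ¬ (G.neighborFinset x).Nonempty)
    (f : V → ENNReal) : ∫⁻ y, f y ∂(step G x).toMeasure = f x := by
  rw [step, dif_neg hx, PMF.toMeasure_pure, lintegral_dirac' _ Measurable.of_discrete]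

/-- At a vertex of `s` all of whose neighbours are in `s`, the walks on `G` and on the graph
induced on `s` take the same step. -/
lemma lintegral_step_induce [Countable V] {s : Set V} (x : s) (hx : ∀ y, G.Adj x y → y ∈ s)
    (f : V → ENNReal) :
    ∫⁻ y, f y ∂(step (G.induce s) x).toMeasure = ∫⁻ y, f y ∂(step G (x : V)).toMeasure := by
  have hmap : ((G.induce s).neighborFinset x).map (Function.Embedding.subtype _) =
      G.neighborFinset (x : V) := by
    ext y
    simp only [Finset.mem_map, SimpleGraph.mem_neighborFinset, SimpleGraph.comap_adj,
      Function.Embedding.subtype_apply]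
    constructor
    · rintro ⟨z, hz, rfl⟩
      exact hz
    · intro h
      exact ⟨⟨y, hx y h⟩, h, rfl⟩
  by_cases hne : ((G.induce s).neighborFinset x).Nonempty
  · rw [lintegral_step_of_nonempty _ hne (fun y : s => f y), lintegral_step_of_nonempty _
      (by rw [← hmap]; exact hne.map), ← hmap, Finset.sum_map, Finset.card_map]
    rfl
  · rw [lintegral_step_of_isolated _ hne (fun y : s => f y), lintegral_step_of_isolated]
    rw [← hmap, Finset.map_nonempty]
    exact hne

/-- If an invariant event is null from `x`, it is null from every neighbour of `x`. -/
lemma law_eq_zero_of_adj [Countable V] {A : Set (ℕ → V)} (hA : MeasurableSet A)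
    (hinv : shift ⁻¹' A = A) {x y : V} (h : G.Adj x y) (hx : law G x A = 0) :
    law G y A = 0 := by
  have hpre : prepend x ⁻¹' A = A := by
    conv_lhs => rw [← hinv]
    rfl
  have hne : y ∈ G.neighborFinset x := by simpa using h
  -- A vanishing average of nonnegative terms has only zero terms.
  rw [law_apply G x hA, hpre, lintegral_step_of_nonempty G ⟨y, hne⟩, mul_eq_zero] at hx
  rcases hx with hx | hx
  · exact Finset.sum_eq_zero_iff.1 hx y hne
  · simp at hx

lemma law_eq_zero_of_connected [Countable V] (hG : G.Connected) {A : Set (ℕ → V)}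
    (hA : MeasurableSet A) (hinv : shift ⁻¹' A = A) {x : V} (hx : law G x A = 0) (y : V) :
    law G y A = 0 := by
  obtain ⟨p⟩ := hG.preconnected x y
  induction p with
  | nil => exact hx
  | cons h p ih => exact ih (law_eq_zero_of_adj G hA hinv h hx)

/-- The trajectories that are in `B` at all times before `n`. -/
def stayingBefore (B : Set V) (n : ℕ) : Set (ℕ → V) := {z | ∀ i < n, z i ∈ B}

lemma measurableSet_stayingBefore (B : Set V) (n : ℕ) : MeasurableSet (stayingBefore B n) := by
  have : stayingBefore B n = ⋂ i, ⋂ (_ : i < n), (fun z : ℕ → V => z i) ⁻¹' B := by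
    ext z; simp [stayingBefore]
  rw [this]
  exact .iInter fun i => .iInter fun _ => measurable_pi_apply i .of_discrete

lemma law_stayingBefore_succ [Countable V] (B : Set V) (n : ℕ) (x : V) :
    law G x (stayingBefore B (n + 1)) =
      B.indicator (fun x => ∫⁻ y, law G y (stayingBefore B n) ∂(step G x).toMeasure) x := by
  rw [law_apply G x (measurableSet_stayingBefore B (n + 1))]
  by_cases hx : x ∈ B
  · have : prepend x ⁻¹' stayingBefore B (n + 1) = stayingBefore B n := by
      ext z
      refine ⟨fun h i hi => h (i + 1) (by omega), fun h i hi => ?_⟩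
      cases i with
      | zero => exact hx
      | succ i => exact h i (by omega)
    rw [Set.indicator_of_mem hx, this]
  · have : prepend x ⁻¹' stayingBefore B (n + 1) = ∅ := by
      ext z
      simp only [Set.mem_preimage, Set.mem_empty_iff_false, iff_false]
      exact fun h => hx (h 0 (Nat.succ_pos n))
    rw [Set.indicator_of_notMem hx, this]
    simp

/-- Continuity from above; finite horizons allow induction on time. -/
lemma law_staying_eq_iInf (B : Set V) (x : V) :
    law G x {z | ∀ i, z i ∈ B} = ⨅ n, law G x (stayingBefore B n) := by
  have : {z : ℕ → V | ∀ i, z i ∈ B} = ⋂ n, stayingBefore B n := by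
    ext z
    simp only [stayingBefore, Set.mem_iInter, Set.mem_ofPred_eq]
    exact ⟨fun h _ i _ => h i, fun h i => h (i + 1) i i.lt_succ_self⟩
  rw [this]
  refine Antitone.measure_iInter (fun m n hmn z hz i hi => hz i (hi.trans_le hmn))
    (fun n => (measurableSet_stayingBefore B n).nullMeasurableSet) ⟨0, measure_ne_top _ _⟩

/-- If all neighbours of vertices of `B` are in `s`, the walks on `G` and on the graph induced
on `s` have the same probability of staying in `B`. -/
lemma law_induce_staying [Countable V] {s B : Set V} (hB : ∀ x ∈ B, ∀ y, G.Adj x y → y ∈ s)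
    (x : s) :
    law (G.induce s) x {z | ∀ i, z i ∈ Subtype.val ⁻¹' B} = law G x {z | ∀ i, z i ∈ B} := by
  rw [law_staying_eq_iInf, law_staying_eq_iInf]
  congr 1
  ext n
  induction n generalizing x with
  | zero => simp [stayingBefore]
  | succ n ih =>
    rw [law_stayingBefore_succ, law_stayingBefore_succ]
    by_cases hx : (x : V) ∈ B
    · rw [Set.indicator_of_mem hx, Set.indicator_of_mem (by exact hx)]
      simp_rw [ih]
      exact lintegral_step_induce G x (hB x hx) fun y => law G y (stayingBefore B n)
    · rw [Set.indicator_of_notMem hx, Set.indicator_of_notMem (by exact hx)]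

variable {G}

/-- A transient walk avoids any given vertex forever with positive probability, when started at
a suitable vertex. -/
lemma Transient.exists_law_avoiding_ne_zero [Countable V] (hG : Transient G) (x : V) :
    ∃ y, law G y {z | ∀ i, z i ∈ ({x}ᶜ : Set V)} ≠ 0 := by
  -- Otherwise `x` is hit almost surely from everywhere, in particular after one step from `x`, so
  -- return is certain.
  by_contra! h
  refine (hG x).ne ?_
  have hm : ∀ n, MeasurableSet {z : ℕ → V | z n = x} := fun n =>
    measurableSet_eq_fun (measurable_pi_apply n) measurable_const
  have hM : MeasurableSet {z : ℕ → V | ∃ n, z n = x} := by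
    have : {z : ℕ → V | ∃ n, z n = x} = ⋃ n, {z | z n = x} := by ext; simp
    rw [this]
    exact .iUnion hm
  have hM' : MeasurableSet {z : ℕ → V | ∃ n, 1 ≤ n ∧ z n = x} := by
    have : {z : ℕ → V | ∃ n, 1 ≤ n ∧ z n = x} = ⋃ n, ⋃ (_ : 1 ≤ n), {z | z n = x} := by
      ext; simp
    rw [this]
    exact .iUnion fun n => .iUnion fun _ => hm n
  have hpre : prepend x ⁻¹' {z : ℕ → V | ∃ n, 1 ≤ n ∧ z n = x} = {z | ∃ n, z n = x} := by
    ext z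
    constructor
    · rintro ⟨_ | n, hn, hz⟩
      · omega
      · exact ⟨n, hz⟩
    · rintro ⟨n, hz⟩
      exact ⟨n + 1, by omega, hz⟩
  have hone : ∀ y, law G y {z | ∃ n, z n = x} = 1 := by
    intro y
    rw [← prob_compl_eq_zero_iff hM, ← h y]
    congr 1
    ext z
    simp
  rw [law_apply G x hM', hpre]
  simp [hone]

lemma measurableSet_eventuallyIn (s : Set V) : MeasurableSet (eventuallyIn s) := by
  have : eventuallyIn s = ⋃ N, ⋂ n, ⋂ (_ : n ≥ N), (fun z : ℕ → V => z n) ⁻¹' s := by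
    ext z; simp [eventuallyIn]
  rw [this]
  exact .iUnion fun N => .iInter fun n => .iInter fun _ => measurable_pi_apply n .of_discrete

/-- If the walk on the subtree rooted at `u` is transient, the walk on the whole graph ends up in
that subtree with positive probability. -/
lemma law_eventuallyIn_descendants_pos [Countable V] (hG : G.Connected) (r u : V)
    (hu : Transient (G.induce (descendants G r u))) (x : V) :
    0 < law G x (eventuallyIn (descendants G r u)) := by
  rw [pos_iff_ne_zero]
  intro hx
  obtain ⟨y, hy⟩ := hu.exists_law_avoiding_ne_zero ⟨u, mem_descendants_self G r u⟩
  refine hy ?_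
  have hset : ({⟨u, mem_descendants_self G r u⟩}ᶜ : Set (descendants G r u)) =
      Subtype.val ⁻¹' (descendants G r u \ {u}) := by
    ext w
    simp [Subtype.ext_iff]
  rw [hset, law_induce_staying G
    (fun w hw w' h => mem_descendants_of_adj G hw.1 hw.2 h)]
  have hsub : {z : ℕ → V | ∀ i, z i ∈ descendants G r u \ {u}} ⊆
      eventuallyIn (descendants G r u) := fun z hz => ⟨0, fun n _ => (hz n).1⟩
  exact measure_mono_null hsub
    (law_eq_zero_of_connected G hG (measurableSet_eventuallyIn _)
      (shift_preimage_eventuallyIn _) hx y)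

end Walk
end TreeWalk

theorem mainTheorem3 {V : Type*} [MeasurableSpace V] [DiscreteMeasurableSpace V]
    (T : SimpleGraph V) [T.LocallyFinite] (hT : T.IsTree) (v : V) (hv : 2 ≤ T.degree v)
    (htrans : ∀ u : V, T.Adj v u →
      TreeWalk.Transient (T.induce (TreeWalk.descendants T v u))) :
    ∀ x : V, TreeWalk.BoundaryNontrivial T x := by
  intro x
  have := TreeWalk.countable_of_connected T hT.connected
  obtain ⟨a, ha, b, hb, hab⟩ := Finset.one_lt_card.1 (show 1 < (T.neighborFinset v).card from hv)
  rw [SimpleGraph.mem_neighborFinset] at ha hb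
  have hpos := TreeWalk.law_eventuallyIn_descendants_pos hT.connected v
  have hdis := TreeWalk.disjoint_eventuallyIn (TreeWalk.disjoint_descendants hT ha hb hab)
  have hbm := TreeWalk.measurableSet_eventuallyIn (TreeWalk.descendants T v b)
  refine ⟨TreeWalk.eventuallyIn (TreeWalk.descendants T v a),
    ⟨TreeWalk.measurableSet_eventuallyIn _, TreeWalk.shift_preimage_eventuallyIn _⟩,
    hpos a (htrans a ha) x, ?_⟩
  -- The event for `a` lies in the complement of the event for `b`, which has positive probability.
  refine (MeasureTheory.measure_mono hdis.subset_compl_right).trans_lt ?_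
  rw [MeasureTheory.prob_compl_eq_one_sub hbm]
  exact ENNReal.sub_lt_self ENNReal.one_ne_top one_ne_zero (hpos b (htrans b hb) x).ne'
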